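/- For a function $f:[0,\infty)\to\mathbb R$ that is Borel measurable and bounded on bounded sets, and a measure $\mu$ on $[0,\infty)$ that is locally finite (finite on bounded Borel sets), let $(f*\mu)(t)=\int_{[0,t]} f(t-s)\,\mu(ds)$, $t\ge 0$. Let $\mu$ be a locally finite measure on $[0,\infty)$ and $\rho$ a probability measure on $[0,\infty)$ with $\rho(\{0\})=0$. A locally finite random measure $\xi$ on $[0,\infty)$ is called a Feller random measure with parameters $(\mu,\rho)$, written $\xi\sim F(\mu,\rho)$, if for every continuous $f:[0,\infty)\to\mathbb R$ with $f(0)=0$ and $f\le 1/2$ the convolutional Riccati equation $$h=\bigl(f+\tfrac12 h^2\bigr)*\rho\quad\text{on }[0,\infty)$$ has a unique solution $h=h[f]$ among the Borel measurable functions that are bounded on bounded sets, and $$\mathbb E\bigl[\exp\bigl((f*\xi)(t)\bigr)\bigr]=\exp\bigl((h[f]*\mu)(t)\bigr)\quad\text{for all }t\ge 0.$$ Proposition. Suppose that $\xi_1\sim F(\mu_1,\rho)$ and $\xi_2\sim F(\mu_2,\rho)$ are defined on the same probability space, where $\mu_1,\mu_2$ are locally finite measures on $[0,\infty)$ and $\rho$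 is a probability measure on $[0,\infty)$ with $\rho(\{0\})=0$. If $\xi_1$ and $\xi_2$ are independent, then $$\xi_1+\xi_2\sim F(\mu_1+\mu_2,\rho).$$ -/

import Mathlib

open MeasureTheory ProbabilityTheory
open scoped NNReal ENNReal

noncomputable section

namespace FellerRandomMeasure

/-- Functions `[0,∞) → ℝ` that are Borel measurable and bounded on bounded sets. -/
def LocBounded (h : ℝ≥0 → ℝ) : Prop :=
  Measurable h ∧ ∀ T : ℝ≥0, ∃ C : ℝ, ∀ t ≤ T, |h t| ≤ C

/-- The convolution `(f * μ)(t) = ∫_{[0,t]} f (t - s) μ(ds)` of a function and a measure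
on `[0,∞)`. On the domain of integration `s ≤ t`, so `t - s` is the true difference. -/
def conv (f : ℝ≥0 → ℝ) (μ : Measure ℝ≥0) (t : ℝ≥0) : ℝ :=
  ∫ s in Set.Iic t, f (t - s) ∂μ

/-- The convolutional moment-generating functional `M_ξ[f](t) = 𝔼[exp ((f * ξ)(t))] ∈ [0,∞]`
of a random measure `ξ` on `[0,∞)` defined on the probability space `(Ω, P)`. -/
def mgf {Ω : Type*} [MeasurableSpace Ω] (P : Measure Ω) (ξ : Ω → Measure ℝ≥0)
    (f : ℝ≥0 → ℝ) (t : ℝ≥0) : ℝ≥0∞ :=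
  ∫⁻ ω, ENNReal.ofReal (Real.exp (conv f (ξ ω) t)) ∂P

/-- `h` is a measurable, locally bounded solution on `[0,∞)` of the convolutional Riccati
equation `h = (f + h² / 2) * ρ`. -/
def IsRiccatiSolution (ρ : Measure ℝ≥0) (f h : ℝ≥0 → ℝ) : Prop :=
  LocBounded h ∧ ∀ t, h t = conv (fun s => f s + (1 / 2) * h s ^ 2) ρ t

/-- `IsFeller P ξ μ ρ` means `ξ ∼ F(μ, ρ)`: on `(Ω, P)`, the map `ξ` is a locally finite random
measure on `[0,∞)` (measurability refers to the σ-algebra on measures generated by the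
evaluation maps) whose law is the Feller law with parameters `μ` (a locally finite measure) and
`ρ` (a probability measure not charging `0`). That is, `M_ξ[f] = exp (h[f] * μ)` on `[0,∞)` for
all continuous `f` with `f 0 = 0` and `f ≤ 1/2`, where `h[f]` is the unique measurable, locally
bounded solution of `h = (f + h² / 2) * ρ`. -/
structure IsFeller {Ω : Type*} [MeasurableSpace Ω] (P : Measure Ω) (ξ : Ω → Measure ℝ≥0)
    (μ ρ : Measure ℝ≥0) : Prop where
  locallyFinite_param : IsLocallyFiniteMeasure μ
  isProbabilityMeasure_param : IsProbabilityMeasure ρ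
  param_zero : ρ {0} = 0
  measurable : Measurable ξ
  locallyFinite : ∀ ω, IsLocallyFiniteMeasure (ξ ω)
  mgf_eq : ∀ f : ℝ≥0 → ℝ, Continuous f → f 0 = 0 → (∀ s, f s ≤ 1 / 2) →
    ∃ h : ℝ≥0 → ℝ, IsRiccatiSolution ρ f h ∧ (∀ h', IsRiccatiSolution ρ f h' → h' = h) ∧
      ∀ t, mgf P ξ f t = ENNReal.ofReal (Real.exp (conv h μ t))

end FellerRandomMeasure

end

/-!
The convolution `f * ν` is additive in the measure `ν` as long as `s ↦ f (t - s)` is integrable on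
`[0, t]`, which holds when `f` is measurable and bounded on bounded sets and `ν` is locally finite
(`conv_add_measure`). Hence `exp ((f * (ξ₁ + ξ₂))(t))` is the product of the two exponentials
`exp ((f * ξᵢ)(t))`, and independence factorizes its expectation into
`exp ((h * μ₁)(t)) * exp ((h * μ₂)(t)) = exp ((h * (μ₁ + μ₂))(t))`. Both factors involve the
same `h`, because the Riccati equation depends on `ρ` and `f` only and its solution is unique.

To use independence of `ξ₁` and `ξ₂`, the variable `(f * ξᵢ)(t)` has to be a measurable function of
`ξᵢ`. The Bochner integral is replaced by `convDiff`, a difference of Lebesgue integrals which is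
measurable on the space of all measures and agrees with `conv` on the locally finite ones.
-/

namespace FellerRandomMeasure

theorem LocBounded.of_continuous {f : ℝ≥0 → ℝ} (hf : Continuous f) : LocBounded f := by
  refine ⟨hf.measurable, fun T => ?_⟩
  obtain ⟨C, hC⟩ := (isCompact_Icc (a := (0 : ℝ≥0)) (b := T)).exists_bound_of_continuousOn
    hf.continuousOn
  exact ⟨C, fun t ht => hC t ⟨zero_le, ht⟩⟩

theorem LocBounded.integrableOn {f : ℝ≥0 → ℝ} (hf : LocBounded f) (ν : Measure ℝ≥0)
    [IsLocallyFiniteMeasure ν] (t : ℝ≥0) :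
    IntegrableOn (fun s => f (t - s)) (Set.Iic t) ν := by
  obtain ⟨C, hC⟩ := hf.2 t
  have hfin : ν (Set.Iic t) < ∞ := by
    rw [← Set.Icc_bot]
    exact isCompact_Icc.measure_lt_top
  exact Measure.integrableOn_of_bounded hfin.ne
    (hf.1.comp (measurable_const.sub measurable_id)).aestronglyMeasurable
    (Filter.Eventually.of_forall fun s => hC _ tsub_le_self)

theorem conv_add_measure {f : ℝ≥0 → ℝ} (hf : LocBounded f) (ν₁ ν₂ : Measure ℝ≥0)
    [IsLocallyFiniteMeasure ν₁] [IsLocallyFiniteMeasure ν₂] (t : ℝ≥0) :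
    conv f (ν₁ + ν₂) t = conv f ν₁ t + conv f ν₂ t := by
  unfold conv
  rw [Measure.restrict_add]
  exact integral_add_measure (hf.integrableOn ν₁ t) (hf.integrableOn ν₂ t)

theorem isLocallyFiniteMeasure_add (ν₁ ν₂ : Measure ℝ≥0)
    [IsLocallyFiniteMeasure ν₁] [IsLocallyFiniteMeasure ν₂] :
    IsLocallyFiniteMeasure (ν₁ + ν₂) := by
  refine ⟨fun x => ?_⟩
  obtain ⟨s, hs, hs'⟩ := ν₁.finiteAt_nhds x
  obtain ⟨u, hu, hu'⟩ := ν₂.finiteAt_nhds x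
  refine ⟨s ∩ u, Filter.inter_mem hs hu, ?_⟩
  rw [Measure.add_apply]
  exact ENNReal.add_lt_top.2 ⟨(measure_mono Set.inter_subset_left).trans_lt hs',
    (measure_mono Set.inter_subset_right).trans_lt hu'⟩

/-- The convolution of `f` and `ν` at `t`, written as the difference of the Lebesgue integrals of
the positive and the negative part. It agrees with `conv` when `s ↦ f (t - s)` is `ν`-integrable
on `[0, t]`. -/
noncomputable def convDiff (f : ℝ≥0 → ℝ) (t : ℝ≥0) (ν : Measure ℝ≥0) : ℝ :=
  (∫⁻ s in Set.Iic t, ENNReal.ofReal (f (t - s)) ∂ν).toReal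
    - (∫⁻ s in Set.Iic t, ENNReal.ofReal (-f (t - s)) ∂ν).toReal

theorem conv_eq_convDiff {f : ℝ≥0 → ℝ} (hf : LocBounded f) (ν : Measure ℝ≥0)
    [IsLocallyFiniteMeasure ν] (t : ℝ≥0) : conv f ν t = convDiff f t ν :=
  integral_eq_lintegral_pos_part_sub_lintegral_neg_part (hf.integrableOn ν t)

theorem measurable_convDiff {f : ℝ≥0 → ℝ} (hf : Measurable f) (t : ℝ≥0) :
    Measurable (convDiff f t) := by
  have hm : Measurable fun s => f (t - s) := hf.comp (measurable_const.sub measurable_id)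
  have hr : Measurable fun ν : Measure ℝ≥0 => ν.restrict (Set.Iic t) := by
    refine Measure.measurable_of_measurable_coe _ fun s hs => ?_
    simp only [Measure.restrict_apply hs]
    exact Measure.measurable_coe (hs.inter measurableSet_Iic)
  exact ((Measure.measurable_lintegral hm.ennreal_ofReal).comp hr).ennreal_toReal.sub
    ((Measure.measurable_lintegral hm.neg.ennreal_ofReal).comp hr).ennreal_toReal

/-- The moment-generating functional of a sum of independent random measures is the product of the
functionals. -/
theorem mgf_add {Ω : Type*} [MeasurableSpace Ω] {P : Measure Ω} {ξ₁ ξ₂ : Ω → Measure ℝ≥0}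
    (hm₁ : Measurable ξ₁) (hm₂ : Measurable ξ₂)
    (hl₁ : ∀ ω, IsLocallyFiniteMeasure (ξ₁ ω)) (hl₂ : ∀ ω, IsLocallyFiniteMeasure (ξ₂ ω))
    (hindep : IndepFun ξ₁ ξ₂ P) {f : ℝ≥0 → ℝ} (hf : LocBounded f) (t : ℝ≥0) :
    mgf P (fun ω => ξ₁ ω + ξ₂ ω) f t = mgf P ξ₁ f t * mgf P ξ₂ f t := by
  have hφ : Measurable fun ν : Measure ℝ≥0 => ENNReal.ofReal (Real.exp (convDiff f t ν)) :=
    (measurable_convDiff hf.1 t).exp.ennreal_ofReal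
  have key := lintegral_mul_eq_lintegral_mul_lintegral_of_indepFun (hφ.comp hm₁) (hφ.comp hm₂)
    (hindep.comp hφ hφ)
  unfold mgf
  simp only [Pi.mul_apply, Function.comp_apply] at key
  simp only [conv_add_measure hf, conv_eq_convDiff hf, Real.exp_add,
    ENNReal.ofReal_mul (Real.exp_nonneg _), key]

end FellerRandomMeasure

theorem proposition4p8 {Ω : Type*} [MeasurableSpace Ω] (P : Measure Ω) [IsProbabilityMeasure P]
    (μ₁ μ₂ ρ : Measure ℝ≥0) [IsLocallyFiniteMeasure μ₁] [IsLocallyFiniteMeasure μ₂]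
    [IsProbabilityMeasure ρ] (hρ : ρ {0} = 0)
    (ξ₁ ξ₂ : Ω → Measure ℝ≥0)
    (h₁ : FellerRandomMeasure.IsFeller P ξ₁ μ₁ ρ)
    (h₂ : FellerRandomMeasure.IsFeller P ξ₂ μ₂ ρ)
    (hindep : IndepFun ξ₁ ξ₂ P) :
    FellerRandomMeasure.IsFeller P (fun ω => ξ₁ ω + ξ₂ ω) (μ₁ + μ₂) ρ := by
  refine ⟨FellerRandomMeasure.isLocallyFiniteMeasure_add μ₁ μ₂, inferInstance, hρ, ?_, ?_, ?_⟩
  · refine Measure.measurable_of_measurable_coe _ fun s hs => ?_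
    simp only [Measure.add_apply]
    exact ((Measure.measurable_coe hs).comp h₁.measurable).add
      ((Measure.measurable_coe hs).comp h₂.measurable)
  · intro ω
    have := h₁.locallyFinite ω
    have := h₂.locallyFinite ω
    exact FellerRandomMeasure.isLocallyFiniteMeasure_add _ _
  · intro f hf hf0 hf2
    obtain ⟨h, hsol, huniq, hmgf₁⟩ := h₁.mgf_eq f hf hf0 hf2
    obtain ⟨h', hsol', -, hmgf₂⟩ := h₂.mgf_eq f hf hf0 hf2
    obtain rfl := huniq h' hsol'
    refine ⟨h', hsol, huniq, fun t => ?_⟩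
    rw [FellerRandomMeasure.mgf_add h₁.measurable h₂.measurable h₁.locallyFinite h₂.locallyFinite
      hindep (.of_continuous hf), hmgf₁, hmgf₂,
      FellerRandomMeasure.conv_add_measure hsol.1, Real.exp_add,
      ENNReal.ofReal_mul (Real.exp_nonneg _)]
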